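/- Let $V$ be a valuation domain with maximal ideal $\mathfrak m$, residue field $V/\mathfrak m$ and field of fractions $K$, and let \[ \mathrm{Int}^{\mathrm R}(V)=\{\varphi\in K(x) \mid \varphi(V)\subseteq V\} \] be the ring of integer-valued rational functions over $V$ (the condition $\varphi(V)\subseteq V$ includes that $\varphi$ has no pole in $V$). Then $\mathrm{Int}^{\mathrm R}(V)$ is a Bézout domain (a domain in which every finitely generated ideal is principal) if and only if $\mathfrak m$ is a principal ideal of $V$ or there exist two nonconstant polynomials of coprime degrees over $V/\mathfrak m$, neither of which has a root in $V/\mathfrak m$. Moreover, if $\mathfrak m$ is not principal and there do not exist two such polynomials over $V/\mathfrak m$, then for every nonzero $t\in\mathfrak m$ the ideal $(x,t)$ of $\mathrm{Int}^{\mathrm R}(V)$ is not principal; in particular $\mathrm{Int}^{\mathrm R}(V)$ is not a Bézout domain. -/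

import Mathlib

open Polynomial

noncomputable section

/-- For a domain `D` with field of fractions `K`, the ring of integer-valued rational functions
`{φ ∈ K(x) | φ(D) ⊆ D}`, as a `D`-subalgebra of `K(x)`. A rational function belongs to it when,
at every `a ∈ D`, it has no pole (the denominator of its reduced fraction does not vanish at `a`)
and its value at `a` lies in `D`. -/
def IntR (D : Type*) (K : Type*) [CommRing D] [IsDomain D] [Field K] [Algebra D K]
    [IsFractionRing D K] : Subalgebra D (RatFunc K) where
  carrier := {φ | ∀ a : D, φ.denom.eval (algebraMap D K a) ≠ 0 ∧
    φ.eval (RingHom.id K) (algebraMap D K a) ∈ Set.range (algebraMap D K)}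
  mul_mem' := by
    intro φ ψ hφ hψ a
    obtain ⟨h1, b, hb⟩ := hφ a
    obtain ⟨h2, c, hc⟩ := hψ a
    refine ⟨fun h0 => ?_, b * c, ?_⟩
    · have := eval_eq_zero_of_dvd_of_eval_eq_zero (RatFunc.denom_mul_dvd φ ψ) h0
      rw [eval_mul] at this
      exact (mul_ne_zero h1 h2) this
    · rw [RatFunc.eval_mul _ _ (by simpa [eval₂_id] using h1) (by simpa [eval₂_id] using h2),
        map_mul, hb, hc]
  add_mem' := by
    intro φ ψ hφ hψ a
    obtain ⟨h1, b, hb⟩ := hφ a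
    obtain ⟨h2, c, hc⟩ := hψ a
    refine ⟨fun h0 => ?_, b + c, ?_⟩
    · have := eval_eq_zero_of_dvd_of_eval_eq_zero (RatFunc.denom_add_dvd φ ψ) h0
      rw [eval_mul] at this
      exact (mul_ne_zero h1 h2) this
    · rw [RatFunc.eval_add _ _ (by simpa [eval₂_id] using h1) (by simpa [eval₂_id] using h2),
        map_add, hb, hc]
  algebraMap_mem' := by
    intro r a
    have h : algebraMap D (RatFunc K) r = RatFunc.C (algebraMap D K r) := by
      rw [IsScalarTower.algebraMap_apply D K (RatFunc K), RatFunc.algebraMap_eq_C]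
    rw [h]
    exact ⟨by simp, r, by simp⟩

/-- The variable `x`, as an element of the ring of integer-valued rational functions. -/
def IntR.x (D : Type*) (K : Type*) [CommRing D] [IsDomain D] [Field K] [Algebra D K]
    [IsFractionRing D K] : IntR D K :=
  ⟨RatFunc.X, fun a => ⟨by simp, a, by simp⟩⟩

/-- There exist two nonconstant polynomials over `k` of coprime degrees, neither of which has a
root in `k`. -/
def HasCoprimeDegreeRootless (k : Type*) [Field k] : Prop :=
  ∃ p q : k[X], 0 < p.natDegree ∧ 0 < q.natDegree ∧ Nat.Coprime p.natDegree q.natDegree ∧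
    (∀ a : k, ¬ p.IsRoot a) ∧ (∀ a : k, ¬ q.IsRoot a)

end

/-! Sufficiency: up to a common factor in `K(x)`, two elements of `IntR V K` are coprime polynomials
`p`, `q`. At each `a` in `V` the pair `(p(a), q(a))` is a nonzero scalar times a unimodular pair, so
quotients of binary forms of equal degree in `(p, q)` take values that depend only on the unimodular
pair. It is thus enough to find forms as in `HasUnimodularForms`. A generator of the maximal ideal
supplies them, and so do rootless residue polynomials of coprime degrees, whose homogenizations are
units at unimodular pairs.

Necessity: a generator `P/Q` of `(x, t)` has valuation `max(v(a), v(t))` at `a`. Substitute `x = t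
u` and scale both polynomials to primitive ones `A`, `B`. When the maximal ideal is not principal,
it contains `z` with valuation as near 1 as needed, and the values of `A` and `B` at `α + z` and at
`1/z` then reveal root multiplicities and degrees modulo the maximal ideal. The multiplicities agree
everywhere, while the degrees differ by one. Removing the roots leaves rootless polynomials of
consecutive, hence coprime, degrees. -/

/-! ### Pointwise criteria for membership and for the Bézout property. -/

section Evaluation

variable {D K : Type*} [CommRing D] [IsDomain D] [Field K] [Algebra D K] [IsFractionRing D K]

theorem IntR.div_mem {P Q : K[X]} (h : ∀ a : D, Q.eval (algebraMap D K a) ≠ 0 ∧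
    P.eval (algebraMap D K a) / Q.eval (algebraMap D K a) ∈ Set.range (algebraMap D K)) :
    algebraMap K[X] (RatFunc K) P / algebraMap K[X] (RatFunc K) Q ∈ IntR D K := by
  intro a
  obtain ⟨hQ, hr⟩ := h a
  set φ := algebraMap K[X] (RatFunc K) P / algebraMap K[X] (RatFunc K) Q with hφ
  have hd : φ.denom.eval (algebraMap D K a) ≠ 0 := fun h0 =>
    hQ (eval_eq_zero_of_dvd_of_eval_eq_zero (RatFunc.denom_div_dvd P Q) h0)
  refine ⟨hd, ?_⟩
  have hQ0 : Q ≠ 0 := by rintro rfl; simp at hQ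
  have hmul : φ * algebraMap K[X] (RatFunc K) Q = algebraMap K[X] (RatFunc K) P :=
    div_mul_cancel₀ _ (RatFunc.algebraMap_ne_zero hQ0)
  have key := congrArg (RatFunc.eval (RingHom.id K) (algebraMap D K a)) hmul
  rw [RatFunc.eval_mul _ _ (by simpa [eval₂_id] using hd) (by simp)] at key
  simp only [RatFunc.eval_algebraMap, Algebra.algebraMap_self, RingHom.id_apply, eval₂_id] at key
  rwa [eq_div_of_mul_eq hQ key]

/-- If every coprime pair of polynomials over `K` has, up to factors in `K[X]`, a common divisor
in `IntR D K` which is a combination of the pair, then `IntR D K` is a Bézout ring. -/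
theorem IntR.isBezout_of_coprime (H : ∀ p q : K[X], IsCoprime p q → ∃ E N₁ N₂ : K[X], ∀ a : D,
      E.eval (algebraMap D K a) ≠ 0 ∧ (p * N₁ + q * N₂).eval (algebraMap D K a) ≠ 0 ∧
      N₁.eval (algebraMap D K a) / E.eval (algebraMap D K a) ∈ Set.range (algebraMap D K) ∧
      N₂.eval (algebraMap D K a) / E.eval (algebraMap D K a) ∈ Set.range (algebraMap D K) ∧
      (p * E).eval (algebraMap D K a) / (p * N₁ + q * N₂).eval (algebraMap D K a) ∈
        Set.range (algebraMap D K) ∧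
      (q * E).eval (algebraMap D K a) / (p * N₁ + q * N₂).eval (algebraMap D K a) ∈
        Set.range (algebraMap D K)) : IsBezout (IntR D K) := by
  classical
  rw [IsBezout.iff_span_pair_isPrincipal]
  intro φ ψ
  by_cases h0 : φ = 0 ∧ ψ = 0
  · rw [h0.1, h0.2]; exact ⟨0, by simp⟩
  set A := algebraMap K[X] (RatFunc K)
  set e := φ.1.denom * ψ.1.denom
  set p := φ.1.num * ψ.1.denom
  set q := ψ.1.num * φ.1.denom
  have hd1 : A φ.1.denom ≠ 0 := RatFunc.algebraMap_ne_zero φ.1.denom_ne_zero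
  have hd2 : A ψ.1.denom ≠ 0 := RatFunc.algebraMap_ne_zero ψ.1.denom_ne_zero
  have hp : φ.1 * A e = A p := by
    simp only [e, p, map_mul]
    rw [← mul_assoc]
    congr 1
    exact (div_eq_iff hd1).1 (RatFunc.num_div_denom φ.1) |>.symm
  have hq : ψ.1 * A e = A q := by
    simp only [e, q, map_mul]
    rw [mul_left_comm, mul_comm (A ψ.1.num)]
    congr 1
    exact (div_eq_iff hd2).1 (RatFunc.num_div_denom ψ.1) |>.symm
  have hg : GCDMonoid.gcd p q ≠ 0 := by
    intro h
    obtain ⟨h1, h2⟩ := (gcd_eq_zero_iff p q).1 h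
    refine h0 ⟨?_, ?_⟩
    · have := (mul_eq_zero.1 h1).resolve_right ψ.1.denom_ne_zero
      exact Subtype.ext (RatFunc.num_eq_zero_iff.1 this)
    · have := (mul_eq_zero.1 h2).resolve_right φ.1.denom_ne_zero
      exact Subtype.ext (RatFunc.num_eq_zero_iff.1 this)
  have hcop := isCoprime_div_gcd_div_gcd_of_gcd_ne_zero hg
  set g := GCDMonoid.gcd p q
  have hp' : p = g * (p / g) := (EuclideanDomain.mul_div_cancel' hg (gcd_dvd_left p q)).symm
  have hq' : q = g * (q / g) := (EuclideanDomain.mul_div_cancel' hg (gcd_dvd_right p q)).symm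
  obtain ⟨E, N₁, N₂, H⟩ := H _ _ hcop
  set p' := p / g
  set q' := q / g
  have hE : A E ≠ 0 := RatFunc.algebraMap_ne_zero (by rintro rfl; simpa using (H 0).1)
  have hN : A p' * A N₁ + A q' * A N₂ ≠ 0 := by
    rw [← map_mul, ← map_mul, ← map_add]
    refine RatFunc.algebraMap_ne_zero fun h => (H 0).2.1 (by rw [h]; simp)
  have he : A e ≠ 0 := by simp only [e, map_mul]; exact mul_ne_zero hd1 hd2
  -- The generator is `u * φ + w * ψ`; `y` and `z` are the cofactors of `φ` and `ψ`.
  let u : IntR D K := ⟨A N₁ / A E, IntR.div_mem fun a => ⟨(H a).1, (H a).2.2.1⟩⟩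
  let w : IntR D K := ⟨A N₂ / A E, IntR.div_mem fun a => ⟨(H a).1, (H a).2.2.2.1⟩⟩
  let y : IntR D K := ⟨A (p' * E) / A (p' * N₁ + q' * N₂),
    IntR.div_mem fun a => ⟨(H a).2.1, (H a).2.2.2.2.1⟩⟩
  let z : IntR D K := ⟨A (q' * E) / A (p' * N₁ + q' * N₂),
    IntR.div_mem fun a => ⟨(H a).2.1, (H a).2.2.2.2.2⟩⟩
  have hφ : φ.1 = A g * A p' / A e := by rw [← map_mul, ← hp', ← hp]; field_simp
  have hψ : ψ.1 = A g * A q' / A e := by rw [← map_mul, ← hq', ← hq]; field_simp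
  have aux : ∀ r, (A N₁ / A E * (A g * A p' / A e) + A N₂ / A E * (A g * A q' / A e)) *
      (r * A E / (A p' * A N₁ + A q' * A N₂)) = A g * r / A e := by
    intro r
    rw [show A N₁ / A E * (A g * A p' / A e) + A N₂ / A E * (A g * A q' / A e) =
      A g * (A p' * A N₁ + A q' * A N₂) / (A E * A e) by ring]
    generalize A p' * A N₁ + A q' * A N₂ = S at hN
    field_simp
  have h1 : φ = (u * φ + w * ψ) * y := Subtype.ext <| by
    simp only [Subalgebra.coe_mul, Subalgebra.coe_add, u, w, y, hφ, hψ, map_mul, map_add, aux]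
  have h2 : ψ = (u * φ + w * ψ) * z := Subtype.ext <| by
    simp only [Subalgebra.coe_mul, Subalgebra.coe_add, u, w, z, hφ, hψ, map_mul, map_add, aux]
  refine ⟨u * φ + w * ψ, le_antisymm ?_ ?_⟩
  · rw [Ideal.span_le, Set.pair_subset_iff]
    exact ⟨Ideal.mem_span_singleton.2 ⟨y, h1⟩, Ideal.mem_span_singleton.2 ⟨z, h2⟩⟩
  · refine (Ideal.span_singleton_le_iff_mem _).2 (Ideal.mem_span_pair.2 ⟨u, w, rfl⟩)

end Evaluation

/-! ### Binary forms on unimodular pairs, and sufficiency. -/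

section Forms

open MvPolynomial in
theorem MvPolynomial.IsHomogeneous.aeval_const_mul {σ R S : Type*} [CommRing R] [CommRing S]
    [Algebra R S] {φ : MvPolynomial σ R} {m : ℕ} (hφ : φ.IsHomogeneous m) (g : S) (c : σ → S) :
    MvPolynomial.aeval (fun i => g * c i) φ = g ^ m * MvPolynomial.aeval c φ := by
  rw [MvPolynomial.aeval_def, MvPolynomial.aeval_def, MvPolynomial.eval₂_eq,
    MvPolynomial.eval₂_eq, Finset.mul_sum]
  refine Finset.sum_congr rfl fun d hd => ?_
  have : ∑ i ∈ d.support, d i = m := (hφ.degree_eq_sum_deg_support hd).symm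
  simp only [mul_pow, Finset.prod_mul_distrib, Finset.prod_pow_eq_pow_sum, this]
  ring

/-- Binary forms `E`, `N₁`, `N₂` of one degree such that `(X₀ N₁ + X₁ N₂) / E` is a unit at every
unimodular pair, with `N₁ / E` and `N₂ / E` integral there. -/
def HasUnimodularForms (V : Type*) [CommRing V] : Prop :=
  ∃ (m : ℕ) (E N₁ N₂ : MvPolynomial (Fin 2) V),
    E.IsHomogeneous m ∧ N₁.IsHomogeneous m ∧ N₂.IsHomogeneous m ∧
    ∀ c : Fin 2 → V, (∃ i, IsUnit (c i)) → MvPolynomial.eval c E ≠ 0 ∧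
      MvPolynomial.eval c E ∣ MvPolynomial.eval c N₁ ∧
      MvPolynomial.eval c E ∣ MvPolynomial.eval c N₂ ∧
      Associated (c 0 * MvPolynomial.eval c N₁ + c 1 * MvPolynomial.eval c N₂)
        (MvPolynomial.eval c E)

variable {V K : Type*} [CommRing V] [IsDomain V] [Field K] [Algebra V K]
  [IsFractionRing V K]

theorem ValuationRing.exists_mul_unimodular [ValuationRing V] (a b : K) (h : a ≠ 0 ∨ b ≠ 0) :
    ∃ (g : K) (c : Fin 2 → V), g ≠ 0 ∧ a = g * algebraMap V K (c 0) ∧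
      b = g * algebraMap V K (c 1) ∧ ∃ i, IsUnit (c i) := by
  by_cases hb : b = 0
  · exact ⟨a, ![1, 0], by simpa [hb] using h, by simp, by simp [hb], 0, by simp⟩
  by_cases ha : a = 0
  · exact ⟨b, ![0, 1], hb, by simp [ha], by simp, 1, by simp⟩
  rcases ValuationRing.isInteger_or_isInteger V (a / b) with ⟨c, hc⟩ | ⟨c, hc⟩
  · exact ⟨b, ![c, 1], hb, by simp [hc, mul_div_cancel₀, hb], by simp, 1, by simp⟩
  · exact ⟨a, ![1, c], ha, by simp, by simp [hc, mul_div_cancel₀, ha], 0, by simp⟩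

/-- Substituting `(p, q)` into the forms works because the scalar `g ^ m` cancels from every
quotient of forms of degree `m`. -/
theorem HasUnimodularForms.isBezout [ValuationRing V] (h : HasUnimodularForms V) :
    IsBezout (IntR V K) := by
  obtain ⟨m, E, N₁, N₂, hE, hN₁, hN₂, H⟩ := h
  refine IntR.isBezout_of_coprime fun p q hpq => ⟨MvPolynomial.aeval ![p, q] E,
    MvPolynomial.aeval ![p, q] N₁, MvPolynomial.aeval ![p, q] N₂, fun a => ?_⟩
  set x := algebraMap V K a
  have hne : p.eval x ≠ 0 ∨ q.eval x ≠ 0 := by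
    by_contra! h
    obtain ⟨u, w, huw⟩ := hpq
    simpa [h.1, h.2] using congrArg (Polynomial.eval x) huw
  obtain ⟨g, c, hg, hp, hq, hc⟩ := ValuationRing.exists_mul_unimodular (V := V) _ _ hne
  have key : ∀ F : MvPolynomial (Fin 2) V, F.IsHomogeneous m →
      (MvPolynomial.aeval ![p, q] F).eval x = g ^ m * algebraMap V K (MvPolynomial.eval c F) := by
    intro F hF
    have h1 : (MvPolynomial.aeval ![p, q] F).eval x =
        MvPolynomial.aeval (fun i => g * algebraMap V K (c i)) F := by
      rw [← Polynomial.coe_aeval_eq_eval, ← AlgHom.restrictScalars_apply V,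
        ← AlgHom.comp_apply]
      congr 1
      ext i
      fin_cases i <;> simp [hp, hq]
    rw [h1, hF.aeval_const_mul]
    congr 1
    rw [show (fun i => algebraMap V K (c i)) = algebraMap V K ∘ c from rfl,
      MvPolynomial.aeval_algebraMap_apply]
    simp
  obtain ⟨h1, ⟨n₁, h2⟩, ⟨n₂, h3⟩, ⟨u, h4⟩⟩ := H c hc
  have hgm : g ^ m ≠ 0 := pow_ne_zero _ hg
  have hE0 : algebraMap V K (MvPolynomial.eval c E) ≠ 0 := by simpa using h1
  have hu : algebraMap V K u ≠ 0 := by simp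
  have h4' : (algebraMap V K (c 0) * algebraMap V K (MvPolynomial.eval c N₁) +
      algebraMap V K (c 1) * algebraMap V K (MvPolynomial.eval c N₂)) * algebraMap V K u =
      algebraMap V K (MvPolynomial.eval c E) := by
    rw [← h4]; simp
  have hN0 : algebraMap V K (c 0) * algebraMap V K (MvPolynomial.eval c N₁) +
      algebraMap V K (c 1) * algebraMap V K (MvPolynomial.eval c N₂) ≠ 0 := by
    intro h; rw [h, zero_mul] at h4'; exact hE0 h4'.symm
  have hN : p.eval x * (g ^ m * algebraMap V K (MvPolynomial.eval c N₁)) +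
      q.eval x * (g ^ m * algebraMap V K (MvPolynomial.eval c N₂)) = g ^ m * g *
      (algebraMap V K (c 0) * algebraMap V K (MvPolynomial.eval c N₁) +
      algebraMap V K (c 1) * algebraMap V K (MvPolynomial.eval c N₂)) := by
    rw [hp, hq]; ring
  simp only [eval_add, eval_mul, key _ hE, key _ hN₁, key _ hN₂, hN]
  refine ⟨mul_ne_zero hgm hE0, mul_ne_zero (mul_ne_zero hgm hg) hN0, ⟨n₁, ?_⟩, ⟨n₂, ?_⟩,
    ⟨c 0 * u, ?_⟩, ⟨c 1 * u, ?_⟩⟩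
  · rw [h2, map_mul]; field_simp
  · rw [h3, map_mul]; field_simp
  · rw [hp, ← h4', map_mul]; field_simp
  · rw [hq, ← h4', map_mul]; field_simp

/-- This covers the zero maximal ideal, where the forms built from a nonzero generator are
unavailable; ordinary Bézout coefficients in `K[X]` suffice. -/
theorem IntR.isBezout_of_isField (h : IsField V) : IsBezout (IntR V K) := by
  have hs : ∀ x : K, x ∈ Set.range (algebraMap V K) := fun x =>
    (IsFractionRing.surjective_iff_isField).2 h x
  refine IntR.isBezout_of_coprime fun p q ⟨u, w, huw⟩ => ⟨1, u, w, fun a => ?_⟩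
  have : p * u + q * w = 1 := by rw [← huw]; ring
  simp [this, hs]

variable [ValuationRing V]
open IsLocalRing

/-- Compare `X₀² + t X₁²` with `X₀³ + t X₁³`: both are units if `c 0` is a unit; otherwise `t ∣ c
0`, and both are `t` times a unit. -/
theorem hasUnimodularForms_of_maximalIdeal_eq_span {t : V} (ht : t ≠ 0)
    (hm : maximalIdeal V = Ideal.span {t}) : HasUnimodularForms V := by
  have hunit : ∀ z : V, IsUnit (1 + t * z) := fun z => by
    have : t * z ∈ maximalIdeal V := hm ▸ Ideal.mul_mem_right _ _ (Ideal.mem_span_singleton_self t)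
    by_contra hn
    have := (maximalIdeal V).sub_mem ((mem_maximalIdeal _).2 hn) this
    simp at this
  refine ⟨2, MvPolynomial.X 0 ^ 2 + MvPolynomial.C t * MvPolynomial.X 1 ^ 2,
    MvPolynomial.X 0 ^ 2, MvPolynomial.C t * MvPolynomial.X 1 ^ 2,
    (MvPolynomial.isHomogeneous_X_pow _ _).add (MvPolynomial.isHomogeneous_C_mul_X_pow _ _ _),
    MvPolynomial.isHomogeneous_X_pow _ _, MvPolynomial.isHomogeneous_C_mul_X_pow _ _ _, ?_⟩
  intro c hc
  simp only [map_add, map_mul, map_pow, MvPolynomial.eval_X, MvPolynomial.eval_C]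
  by_cases h0 : IsUnit (c 0)
  · obtain ⟨a, ha⟩ := h0.exists_right_inv
    have e1 : c 0 ^ 2 + t * c 1 ^ 2 = c 0 ^ 2 * (1 + t * (a * c 1) ^ 2) := by
      linear_combination (- t * c 1 ^ 2 * (c 0 * a + 1)) * ha
    have e2 : c 0 * c 0 ^ 2 + c 1 * (t * c 1 ^ 2) = c 0 ^ 3 * (1 + t * (a * c 1) ^ 3) := by
      linear_combination (- t * c 1 ^ 3 * (c 0 ^ 2 * a ^ 2 + c 0 * a + 1)) * ha
    have u1 : IsUnit (c 0 ^ 2 + t * c 1 ^ 2) := e1 ▸ (h0.pow 2).mul (hunit _)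
    have u2 : IsUnit (c 0 * c 0 ^ 2 + c 1 * (t * c 1 ^ 2)) := e2 ▸ (h0.pow 3).mul (hunit _)
    exact ⟨u1.ne_zero, u1.dvd, u1.dvd, (associated_one_iff_isUnit.2 u2).trans
      (associated_one_iff_isUnit.2 u1).symm⟩
  · have h1 : IsUnit (c 1) := by
      obtain ⟨i, hi⟩ := hc
      fin_cases i
      exacts [absurd hi h0, hi]
    obtain ⟨b, hb⟩ : t ∣ c 0 := by
      rw [← Ideal.mem_span_singleton, ← hm]; exact (mem_maximalIdeal _).2 h0
    obtain ⟨a, ha⟩ := h1.exists_right_inv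
    have e1 : c 0 ^ 2 + t * c 1 ^ 2 = t * (c 1 ^ 2 * (1 + t * (a * b) ^ 2)) := by
      rw [hb]
      linear_combination (- t ^ 2 * b ^ 2 * (c 1 * a + 1)) * ha
    have e2 : c 0 * c 0 ^ 2 + c 1 * (t * c 1 ^ 2) =
        t * (c 1 ^ 3 * (1 + t * (t * (a * b) ^ 3))) := by
      rw [hb]
      linear_combination (- t ^ 3 * b ^ 3 * (c 1 ^ 2 * a ^ 2 + c 1 * a + 1)) * ha
    have u1 := (h1.pow 2).mul (hunit ((a * b) ^ 2))
    have u2 := (h1.pow 3).mul (hunit (t * (a * b) ^ 3))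
    rw [e2, e1]
    refine ⟨mul_ne_zero ht u1.ne_zero, ?_, mul_dvd_mul_left t u1.dvd, ?_⟩
    · rw [show c 0 ^ 2 = t * (t * b ^ 2) by rw [hb]; ring]
      exact mul_dvd_mul_left t u1.dvd
    · exact (Associated.refl t).mul_mul ((associated_one_iff_isUnit.2 u2).trans
        (associated_one_iff_isUnit.2 u1).symm)

/-- A rootless polynomial over the residue field gives a binary form over `V` that takes unit
values at unimodular pairs. -/
theorem exists_form_of_rootless (f : (ResidueField V)[X]) (hf : 0 < f.natDegree)
    (hr : ∀ a, ¬ f.IsRoot a) : ∃ F₁ F₂ : MvPolynomial (Fin 2) V,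
      F₁.IsHomogeneous (f.natDegree - 1) ∧ F₂.IsHomogeneous (f.natDegree - 1) ∧
      ∀ c : Fin 2 → V, (∃ i, IsUnit (c i)) →
        IsUnit (c 0 * MvPolynomial.eval c F₁ + c 1 * MvPolynomial.eval c F₂) := by
  obtain ⟨n, hn⟩ : ∃ n, f.natDegree = n + 1 := ⟨f.natDegree - 1, by omega⟩
  obtain ⟨φ, hφ⟩ := Polynomial.map_surjective _ residue_surjective f
  have hco : ∀ i, residue V (φ.coeff i) = f.coeff i := fun i => by rw [← hφ, coeff_map]
  rw [hn, Nat.add_sub_cancel]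
  refine ⟨∑ i ∈ Finset.range (n + 1), MvPolynomial.C (φ.coeff (i + 1)) *
      (MvPolynomial.X 0 ^ i * MvPolynomial.X 1 ^ (n - i)),
    MvPolynomial.C (φ.coeff 0) * MvPolynomial.X 1 ^ n, ?_, ?_, ?_⟩
  · refine MvPolynomial.IsHomogeneous.sum _ _ _ fun i hi => ?_
    have hin : i + (n - i) = n := by have := Finset.mem_range.1 hi; omega
    refine MvPolynomial.IsHomogeneous.C_mul ?_ _
    conv => arg 2; rw [← hin]
    exact (MvPolynomial.isHomogeneous_X_pow _ _).mul (MvPolynomial.isHomogeneous_X_pow _ _)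
  · exact MvPolynomial.isHomogeneous_C_mul_X_pow _ _ _
  intro c hc
  rw [← residue_ne_zero_iff_isUnit]
  set a := residue V (c 0) with ha
  set b := residue V (c 1) with hb
  have e : residue V (c 0 * MvPolynomial.eval c (∑ i ∈ Finset.range (n + 1),
      MvPolynomial.C (φ.coeff (i + 1)) * (MvPolynomial.X 0 ^ i * MvPolynomial.X 1 ^ (n - i))) +
      c 1 * MvPolynomial.eval c (MvPolynomial.C (φ.coeff 0) * MvPolynomial.X 1 ^ n)) =
      ∑ i ∈ Finset.range (n + 2), f.coeff i * (a ^ i * b ^ (n + 1 - i)) := by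
    rw [Finset.sum_range_succ' _ (n + 1)]
    simp only [map_add, map_mul, map_sum, map_pow, MvPolynomial.eval_X, MvPolynomial.eval_C, hco,
      Finset.mul_sum, ← ha, ← hb]
    congr 1
    · refine Finset.sum_congr rfl fun i _ => ?_
      rw [Nat.add_sub_add_right]; ring
    · simp; ring
  rw [e]
  -- At `b = 0` only the leading term survives; elsewhere the form is a power of `b` times `f (a /
  -- b)`.
  by_cases hb0 : b = 0
  · have ha0 : a ≠ 0 := by
      obtain ⟨i, hi⟩ := hc
      fin_cases i
      · exact (residue_ne_zero_iff_isUnit _).2 hi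
      · exact absurd hb0 ((residue_ne_zero_iff_isUnit _).2 hi)
    rw [Finset.sum_range_succ, Finset.sum_eq_zero fun i hi => ?_]
    · have : f.leadingCoeff ≠ 0 := leadingCoeff_ne_zero.2 (by rintro rfl; simp at hf)
      rw [leadingCoeff, hn] at this
      simpa using mul_ne_zero this ha0
    · have := Finset.mem_range.1 hi
      rw [hb0, zero_pow (by omega)]; simp
  · have : ∑ i ∈ Finset.range (n + 2), f.coeff i * (a ^ i * b ^ (n + 1 - i)) =
        b ^ (n + 1) * f.eval (a / b) := by
      rw [eval_eq_sum_range, hn, Finset.mul_sum]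
      refine Finset.sum_congr rfl fun i hi => ?_
      have hin : n + 1 = i + (n + 1 - i) := by have := Finset.mem_range.1 hi; omega
      conv_rhs => rw [hin, pow_add, div_pow]
      field_simp
    rw [this]
    exact mul_ne_zero (pow_ne_zero _ hb0) (hr _)

/-- With `F` and `G` the forms of `f` and `g`, coprimality of degrees gives powers with `deg F^(r+1)
= deg G^s + 1`. Take `E = G^s` and `Nᵢ = Fᵢ F^r`, so that `X₀ N₁ + X₁ N₂ = F^(r+1)`. -/
theorem hasUnimodularForms_of_hasCoprimeDegreeRootless
    (h : HasCoprimeDegreeRootless (ResidueField V)) : HasUnimodularForms V := by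
  obtain ⟨f, g, hf, hg, hcop, hfr, hgr⟩ := h
  obtain ⟨F₁, F₂, hF₁, hF₂, hF⟩ := exists_form_of_rootless f hf hfr
  obtain ⟨G₁, G₂, hG₁, hG₂, hG⟩ := exists_form_of_rootless g hg hgr
  obtain ⟨r, s, hrs⟩ : ∃ r s : ℕ, f.natDegree * (r + 1) = g.natDegree * s + 1 := by
    obtain ⟨r, -, hr⟩ := Nat.exists_mul_mod_eq_of_coprime 1 hcop hg.ne'
    have h1 : 1 ≤ f.natDegree * (r + g.natDegree) := Nat.mul_pos hf (by omega)
    have h2 : 1 ≡ f.natDegree * (r + g.natDegree) [MOD g.natDegree] := by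
      rw [Nat.ModEq, ← hr, mul_add, Nat.add_mul_mod_self_right]
    obtain ⟨s, hs⟩ := (Nat.modEq_iff_dvd' h1).1 h2
    -- Adding `g.natDegree` keeps the multiplier positive, so the subtraction does not truncate.
    exact ⟨r + g.natDegree - 1, s, by rw [Nat.sub_add_cancel (by omega)]; omega⟩
  have hlin : ∀ (k : ℕ) (A B : MvPolynomial (Fin 2) V), 0 < k → A.IsHomogeneous (k - 1) →
      B.IsHomogeneous (k - 1) →
      (MvPolynomial.X 0 * A + MvPolynomial.X 1 * B).IsHomogeneous k := by
    intro k A B hk hA hB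
    have := ((MvPolynomial.isHomogeneous_X V (0 : Fin 2)).mul hA).add
      ((MvPolynomial.isHomogeneous_X V (1 : Fin 2)).mul hB)
    rwa [Nat.add_sub_cancel' hk] at this
  have hFh := (hlin _ _ _ hf hF₁ hF₂).pow r
  have hdeg : f.natDegree - 1 + f.natDegree * r = g.natDegree * s := by
    rw [mul_add] at hrs; omega
  refine ⟨g.natDegree * s, (MvPolynomial.X 0 * G₁ + MvPolynomial.X 1 * G₂) ^ s,
    F₁ * (MvPolynomial.X 0 * F₁ + MvPolynomial.X 1 * F₂) ^ r,
    F₂ * (MvPolynomial.X 0 * F₁ + MvPolynomial.X 1 * F₂) ^ r,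
    (hlin _ _ _ hg hG₁ hG₂).pow s, hdeg ▸ hF₁.mul hFh, hdeg ▸ hF₂.mul hFh, fun c hc => ?_⟩
  simp only [map_add, map_mul, map_pow, MvPolynomial.eval_X]
  have u1 := (hG c hc).pow s
  have u2 := (hF c hc).pow (r + 1)
  refine ⟨u1.ne_zero, u1.dvd, u1.dvd, ?_⟩
  rw [← mul_assoc, ← mul_assoc, ← add_mul, ← pow_succ']
  exact (associated_one_iff_isUnit.2 u2).trans (associated_one_iff_isUnit.2 u1).symm

end Forms

/-! ### Removing roots from residue polynomials. -/

section ResiduePolynomials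

theorem hasCoprimeDegreeRootless_of_rootMultiplicity_eq {k : Type*} [Field k] {f g : k[X]}
    (hm : ∀ a, f.rootMultiplicity a = g.rootMultiplicity a)
    (hd : f.natDegree = g.natDegree + 1) : HasCoprimeDegreeRootless k := by
  classical
  obtain ⟨p, hp, hpd, hpr⟩ := exists_prod_multiset_X_sub_C_mul f
  obtain ⟨q, hq, hqd, hqr⟩ := exists_prod_multiset_X_sub_C_mul g
  have hroots : f.roots = g.roots := Multiset.ext.2 fun a => by simp [hm]
  rw [hroots] at hpd
  have hf : f ≠ 0 := by rintro rfl; simp at hd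
  have hp0 : p ≠ 0 := by rintro rfl; exact hf (by simpa using hp.symm)
  have hpq : p.natDegree = q.natDegree + 1 := by omega
  have hproot : ∀ a, ¬ p.IsRoot a := fun a ha => by
    have := (mem_roots hp0).2 ha
    simp [hpr] at this
  -- If `q` were constant, `p` would be linear and so have a root.
  have hq1 : 0 < q.natDegree := by
    by_contra h
    obtain ⟨a, ha⟩ := exists_root_of_degree_eq_one (p := p)
      (by rw [degree_eq_natDegree hp0, hpq, Nat.eq_zero_of_not_pos h]; rfl)
    exact hproot a ha
  have hq0 : q ≠ 0 := by rintro rfl; simp at hq1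
  refine ⟨p, q, by omega, hq1, ?_, hproot, fun a ha => ?_⟩
  · rw [hpq]; simp
  · have := (mem_roots hq0).2 ha
    simp [hqr] at this

end ResiduePolynomials

/-! ### Elements of the maximal ideal whose high powers divide given elements. -/

section SmallElements

open IsLocalRing

/-- The first unit coefficient dominates: lower coefficients, collected in `S`, are divisible by `z
^ (e + 1)` by assumption, and higher terms contain that power. -/
theorem associated_eval_pow {V : Type*} [CommRing V] [IsLocalRing V] (A : V[X]) {e : ℕ}
    (hlt : ∀ i < e, A.coeff i ∈ maximalIdeal V) (he : IsUnit (A.coeff e)) :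
    ∃ S : Finset V, (∀ s ∈ S, s ∈ maximalIdeal V) ∧ ∀ z ∈ maximalIdeal V,
      (∀ s ∈ S, z ^ (e + 1) ∣ s) → Associated (A.eval z) (z ^ e) := by
  classical
  refine ⟨(Finset.range e).image A.coeff, by simpa using hlt, fun z hz hS => ?_⟩
  have hmem : e ∈ Finset.range (A.natDegree + 1) :=
    Finset.mem_range.2 (Nat.lt_succ_of_le (le_natDegree_of_ne_zero he.ne_zero))
  have hdvd : z ^ (e + 1) ∣ ∑ i ∈ (Finset.range (A.natDegree + 1)).erase e,
      A.coeff i * z ^ i := by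
    refine Finset.dvd_sum fun i hi => ?_
    rcases lt_or_gt_of_ne (Finset.ne_of_mem_erase hi) with h | h
    · exact (hS _ (Finset.mem_image_of_mem _ (Finset.mem_range.2 h))).mul_right _
    · exact (pow_dvd_pow z h).mul_left _
  obtain ⟨r, hr⟩ := hdvd
  have : A.eval z = z ^ e * (A.coeff e + z * r) := by
    rw [eval_eq_sum_range, ← Finset.add_sum_erase _ _ hmem, hr]; ring
  have hu : IsUnit (A.coeff e + z * r) := by
    by_contra hn
    exact (maximalIdeal V).sub_mem ((mem_maximalIdeal _).2 hn)
      ((maximalIdeal V).mul_mem_right r hz) (by simpa using he)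
  rw [this]
  exact (associated_mul_unit_left _ _ hu)

variable {V : Type*} [CommRing V] [IsDomain V] [ValuationRing V]

/-- As `s` does not generate the maximal ideal, it is a product of two nonunits; whichever divides
the other has its square dividing `s`. -/
theorem exists_sq_dvd_of_not_isPrincipal (hm : ¬ (maximalIdeal V).IsPrincipal) {s : V}
    (hs : s ∈ maximalIdeal V) (hs0 : s ≠ 0) :
    ∃ z ∈ maximalIdeal V, z ≠ 0 ∧ z ^ 2 ∣ s := by
  obtain ⟨y, hy, hys⟩ : ∃ y ∈ maximalIdeal V, ¬ s ∣ y := by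
    by_contra! h
    exact hm ⟨s, le_antisymm (fun y hy => Ideal.mem_span_singleton.2 (h y hy))
      ((Ideal.span_singleton_le_iff_mem _).2 hs)⟩
  obtain ⟨w, rfl⟩ := (ValuationRing.dvd_total s y).resolve_left hys
  have hw : w ∈ maximalIdeal V := by
    rw [mem_maximalIdeal]
    intro hu
    exact hys (hu.mul_right_dvd.2 dvd_rfl)
  rcases ValuationRing.dvd_total y w with h | h
  · exact ⟨y, hy, left_ne_zero_of_mul hs0, by rw [pow_two]; exact mul_dvd_mul_left y h⟩
  · exact ⟨w, hw, right_ne_zero_of_mul hs0, by rw [pow_two]; exact mul_dvd_mul_right h w⟩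

theorem exists_pow_dvd_of_not_isPrincipal (hm : ¬ (maximalIdeal V).IsPrincipal) (n : ℕ) {s : V}
    (hs : s ∈ maximalIdeal V) (hs0 : s ≠ 0) :
    ∃ z ∈ maximalIdeal V, z ≠ 0 ∧ z ^ n ∣ s := by
  suffices ∃ z ∈ maximalIdeal V, z ≠ 0 ∧ z ^ 2 ^ n ∣ s by
    obtain ⟨z, hz, hz0, h⟩ := this
    exact ⟨z, hz, hz0, (pow_dvd_pow z Nat.lt_two_pow_self.le).trans h⟩
  induction n with
  | zero => exact ⟨s, hs, hs0, by simp⟩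
  | succ n ih =>
    obtain ⟨z, hz, hz0, h⟩ := ih
    obtain ⟨y, hy, hy0, h'⟩ := exists_sq_dvd_of_not_isPrincipal hm hz hz0
    exact ⟨y, hy, hy0, (by rw [pow_succ', pow_mul]; exact pow_dvd_pow_of_dvd h' _ :
      y ^ 2 ^ (n + 1) ∣ z ^ 2 ^ n).trans h⟩

theorem exists_pow_dvd_finset_of_not_isPrincipal (hm : ¬ (maximalIdeal V).IsPrincipal) (n : ℕ)
    (S : Finset V) (hS : ∀ s ∈ S, s ∈ maximalIdeal V) :
    ∃ z ∈ maximalIdeal V, z ≠ 0 ∧ ∀ s ∈ S, z ^ n ∣ s := by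
  classical
  obtain ⟨w, hw, hw0, hwS⟩ : ∃ w ∈ maximalIdeal V, w ≠ 0 ∧ ∀ s ∈ S, w ∣ s := by
    induction S using Finset.induction_on with
    | empty =>
      obtain ⟨w, hw, hw0⟩ := Submodule.exists_mem_ne_zero_of_ne_bot
        (fun h : maximalIdeal V = ⊥ => hm (h ▸ inferInstance))
      exact ⟨w, hw, hw0, by simp⟩
    | insert s S _ ih =>
      obtain ⟨w, hw, hw0, hwS⟩ := ih fun x hx => hS x (Finset.mem_insert_of_mem hx)
      rcases ValuationRing.dvd_total w s with h | h
      · exact ⟨w, hw, hw0, by simpa using ⟨h, hwS⟩⟩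
      · refine ⟨s, hS s (Finset.mem_insert_self _ _), ?_, ?_⟩
        · rintro rfl; exact hw0 (zero_dvd_iff.1 h)
        · simpa using fun x hx => h.trans (hwS x hx)
  obtain ⟨z, hz, hz0, h⟩ := exists_pow_dvd_of_not_isPrincipal hm n hw hw0
  exact ⟨z, hz, hz0, fun s hs => h.trans (hwS s hs)⟩

end SmallElements

/-! ### Reading multiplicities and degrees from valuations. -/

section Valuation

open IsLocalRing ValuationRing

variable {V K : Type*} [CommRing V] [IsDomain V] [ValuationRing V] [Field K] [Algebra V K]
  [IsFractionRing V K]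

theorem valuation_algebraMap_eq_of_associated {a b : V} (h : Associated a b) :
    valuation V K (algebraMap V K a) = valuation V K (algebraMap V K b) := by
  have hle : ∀ {a b : V}, a ∣ b →
      valuation V K (algebraMap V K b) ≤ valuation V K (algebraMap V K a) := by
    rintro a _ ⟨c, rfl⟩
    rw [map_mul, map_mul]
    exact mul_le_of_le_one_right' ((mem_integer_iff V K _).2 ⟨c, rfl⟩)
  exact le_antisymm (hle h.symm.dvd) (hle h.dvd)

theorem valuation_algebraMap_lt_one {a : V} (h : a ∈ maximalIdeal V) :
    valuation V K (algebraMap V K a) < 1 := by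
  refine lt_of_le_of_ne ((mem_integer_iff V K _).2 ⟨a, rfl⟩) fun h1 => h ?_
  have ha : algebraMap V K a ≠ 0 := by
    intro h0; rw [h0, map_zero] at h1; exact zero_ne_one h1
  obtain ⟨b, hb⟩ := (mem_integer_iff V K (algebraMap V K a)⁻¹).1
    (by change valuation V K _ ≤ 1; rw [map_inv₀, h1, inv_one])
  refine IsUnit.of_mul_eq_one b (IsFractionRing.injective V K ?_)
  rw [map_mul, hb, map_one, mul_inv_cancel₀ ha]

/-- Divide by a coefficient of largest valuation; that coefficient becomes 1. -/
theorem exists_primitive_polynomial {F : K[X]} (hF : F ≠ 0) : ∃ (c : K) (A : V[X]), c ≠ 0 ∧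
    F = C c * A.map (algebraMap V K) ∧ A.map (residue V) ≠ 0 := by
  obtain ⟨i, hi, hmax⟩ := F.support.exists_max_image (fun i => valuation V K (F.coeff i))
    (nonempty_support_iff.2 hF)
  have hc : F.coeff i ≠ 0 := mem_support_iff.1 hi
  have hint : ∀ j, ∃ a : V, algebraMap V K a = (F.coeff i)⁻¹ * F.coeff j := by
    intro j
    refine (mem_integer_iff V K _).1 ?_
    change valuation V K _ ≤ 1
    by_cases hj : F.coeff j = 0
    · simp [hj]
    · rw [map_mul, map_inv₀, ← div_eq_inv_mul]
      exact div_le_one_of_le₀ (hmax j (mem_support_iff.2 hj)) zero_le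
  obtain ⟨A, hA⟩ := (mem_lifts (C (F.coeff i)⁻¹ * F)).1
    ((lifts_iff_coeff_lifts (f := algebraMap V K) _).2 fun j => by
      obtain ⟨a, ha⟩ := hint j
      exact ⟨a, by rw [ha, coeff_C_mul]⟩)
  refine ⟨F.coeff i, A, hc, ?_, fun h => ?_⟩
  · rw [hA, ← mul_assoc, ← C_mul, mul_inv_cancel₀ hc, C_1, one_mul]
  · have h1 : A.coeff i = 1 := IsFractionRing.injective V K <| by
      rw [← coeff_map, hA, coeff_C_mul, inv_mul_cancel₀ hc, map_one]
    have := congrArg (fun p => p.coeff i) h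
    simp [coeff_map, h1] at this

/-- The root multiplicity is the index of the first unit coefficient of the Taylor expansion at `α`.
-/
theorem associated_eval_add_pow_rootMultiplicity (A : V[X]) (hA : A.map (residue V) ≠ 0) (α : V) :
    ∃ S : Finset V, (∀ s ∈ S, s ∈ maximalIdeal V) ∧ ∀ z ∈ maximalIdeal V,
      (∀ s ∈ S, z ^ ((A.map (residue V)).rootMultiplicity (residue V α) + 1) ∣ s) →
      Associated (A.eval (z + α)) (z ^ (A.map (residue V)).rootMultiplicity (residue V α)) := by
  have hT : (taylor α A).map (residue V) = (A.map (residue V)).comp (X + C (residue V α)) := by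
    rw [map_taylor, taylor_apply]
  have hT0 : (taylor α A).map (residue V) ≠ 0 := by
    rw [map_taylor]; exact (taylor_eq_zero _ _).not.2 hA
  rw [rootMultiplicity_eq_natTrailingDegree, ← hT]
  simp only [← taylor_eval]
  refine associated_eval_pow _ (fun i hi => ?_) ?_
  · rw [← residue_eq_zero_iff, ← coeff_map]
    exact coeff_eq_zero_of_lt_natTrailingDegree hi
  · rw [← residue_ne_zero_iff_isUnit, ← coeff_map]
    exact trailingCoeff_nonzero_iff_nonzero.2 hT0

/-- Apply `associated_eval_pow` to the reversed polynomial, whose first unit coefficient is the last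
one of `A`. -/
theorem valuation_eval_inv (A : V[X]) (hA : A.map (residue V) ≠ 0) :
    ∃ (S : Finset V) (n : ℕ), (∀ s ∈ S, s ∈ maximalIdeal V) ∧ ∀ z ∈ maximalIdeal V, z ≠ 0 →
      (∀ s ∈ S, z ^ n ∣ s) →
      valuation V K ((A.map (algebraMap V K)).eval (algebraMap V K z)⁻¹) *
        valuation V K (algebraMap V K z) ^ (A.map (residue V)).natDegree = 1 := by
  set d := (A.map (residue V)).natDegree
  have hd : d ≤ A.natDegree := natDegree_map_le
  obtain ⟨S, hS, h⟩ := associated_eval_pow A.reverse (e := A.natDegree - d)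
    (fun i hi => by
      rw [← residue_eq_zero_iff, coeff_reverse, ← coeff_map, revAt_le (by omega)]
      exact coeff_eq_zero_of_natDegree_lt (by omega))
    (by
      rw [← residue_ne_zero_iff_isUnit, coeff_reverse, ← coeff_map, revAt_le (by omega),
        Nat.sub_sub_self hd]
      exact leadingCoeff_ne_zero.2 hA)
  refine ⟨S, A.natDegree - d + 1, hS, fun z hz hz0 hzS => ?_⟩
  have hz' : algebraMap V K z ≠ 0 := by simpa using hz0
  have hv : valuation V K (algebraMap V K z) ≠ 0 := (Valuation.ne_zero_iff _).2 hz'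
  let := invertibleOfNonzero (inv_ne_zero hz')
  have key := eval₂_reverse_mul_pow (algebraMap V K) (algebraMap V K z)⁻¹ A
  rw [invOf_eq_inv, inv_inv, eval₂_at_apply] at key
  rw [eval_map, ← key, map_mul, valuation_algebraMap_eq_of_associated (h z hz hzS), map_pow,
    map_pow, map_pow, map_inv₀]
  rw [inv_pow, mul_right_comm, ← pow_add, Nat.sub_add_cancel hd, mul_inv_cancel₀ (pow_ne_zero _ hv)]

theorem eq_one_and_rootMultiplicity_eq (hm : ¬ (maximalIdeal V).IsPrincipal) {A B : V[X]}
    (hA : A.map (residue V) ≠ 0) (hB : B.map (residue V) ≠ 0) {c : ValueGroup V K}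
    (h : ∀ u : V, valuation V K (algebraMap V K (A.eval u)) =
      c * valuation V K (algebraMap V K (B.eval u))) (α : V) :
    c = 1 ∧ (A.map (residue V)).rootMultiplicity (residue V α) =
      (B.map (residue V)).rootMultiplicity (residue V α) := by
  classical
  obtain ⟨S, hS, hSA⟩ := associated_eval_add_pow_rootMultiplicity A hA α
  obtain ⟨T, hT, hTB⟩ := associated_eval_add_pow_rootMultiplicity B hB α
  set e := (A.map (residue V)).rootMultiplicity (residue V α)
  set e' := (B.map (residue V)).rootMultiplicity (residue V α)
  -- The factor 2 allows evaluation at both `z + α` and `z ^ 2 + α`. Comparing the two gives `c ^ 2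
  -- = c`, hence `c = 1`.
  obtain ⟨z, hz, hz0, hzd⟩ := exists_pow_dvd_finset_of_not_isPrincipal hm (2 * (e + e' + 1))
    (S ∪ T) (by simpa [or_imp, forall_and] using ⟨hS, hT⟩)
  have key : ∀ j, 0 < j → j ≤ 2 →
      (valuation V K (algebraMap V K z) ^ e) ^ j =
        c * (valuation V K (algebraMap V K z) ^ e') ^ j := by
    intro j hj hj2
    have hzj : z ^ j ∈ maximalIdeal V := Ideal.pow_mem_of_mem _ hz _ hj
    have h1 := hSA (z ^ j) hzj fun s hs => by
      rw [← pow_mul]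
      exact (pow_dvd_pow z (by nlinarith)).trans (hzd s (Finset.mem_union_left _ hs))
    have h2 := hTB (z ^ j) hzj fun s hs => by
      rw [← pow_mul]
      exact (pow_dvd_pow z (by nlinarith)).trans (hzd s (Finset.mem_union_right _ hs))
    have := h (z ^ j + α)
    rw [valuation_algebraMap_eq_of_associated h1, valuation_algebraMap_eq_of_associated h2] at this
    simpa only [map_pow, pow_right_comm] using this
  have hv : valuation V K (algebraMap V K z) ≠ 0 := (Valuation.ne_zero_iff _).2 (by simpa using hz0)
  have hv1 := valuation_algebraMap_lt_one (K := K) hz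
  set γ := valuation V K (algebraMap V K z)
  have k1 := key 1 one_pos one_le_two
  have k2 := key 2 two_pos le_rfl
  rw [pow_one, pow_one] at k1
  have hc0 : c ≠ 0 := by
    rintro rfl
    rw [zero_mul] at k1
    exact pow_ne_zero _ hv k1
  have hc : c = 1 := by
    rw [k1, mul_pow] at k2
    have := mul_right_cancel₀ (pow_ne_zero 2 (pow_ne_zero e' hv)) k2
    rw [pow_two] at this
    exact mul_left_cancel₀ hc0 (by rw [this, mul_one])
  refine ⟨hc, ?_⟩
  rw [hc, one_mul] at k1
  exact pow_right_injective₀ (zero_lt_iff.2 hv) hv1.ne k1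

/-- A rational function whose value at each `a` in `V` generates `(a, t)` yields two polynomials
without roots in the residue field whose degrees differ by one. -/
theorem hasCoprimeDegreeRootless_of_valuation_eval
    (hm : ¬ (maximalIdeal V).IsPrincipal) {t : V} (ht : t ∈ maximalIdeal V) (ht0 : t ≠ 0)
    (P Q : K[X]) (hQ : ∀ a : V, Q.eval (algebraMap V K a) ≠ 0)
    (h : ∀ a : V, valuation V K (P.eval (algebraMap V K a)) =
      valuation V K (Q.eval (algebraMap V K a)) *
        max (valuation V K (algebraMap V K a)) (valuation V K (algebraMap V K t))) :
    HasCoprimeDegreeRootless (ResidueField V) := by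
  classical
  have ht' : algebraMap V K t ≠ 0 := by simpa using ht0
  have hvt : valuation V K (algebraMap V K t) ≠ 0 := (Valuation.ne_zero_iff _).2 ht'
  have hcomp : ∀ F : K[X], F ≠ 0 → F.comp (C (algebraMap V K t) * X) ≠ 0 := fun F hF h0 => by
    rcases comp_eq_zero_iff.1 h0 with h0 | ⟨-, h0⟩
    · exact hF h0
    · have := congrArg (fun p => p.coeff 1) h0
      simp at this
      exact ht0 this
  have hQ0 : Q ≠ 0 := by rintro rfl; simpa using hQ 0
  have hP0 : P ≠ 0 := by
    rintro rfl
    have := h 0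
    simp [hvt] at this
    exact hQ 0 (by simpa using this)
  obtain ⟨p, A, hp, hPA, hA⟩ := exists_primitive_polynomial (V := V) (hcomp P hP0)
  obtain ⟨q, B, hq, hQB, hB⟩ := exists_primitive_polynomial (V := V) (hcomp Q hQ0)
  have hPe : ∀ x : K, P.eval (algebraMap V K t * x) = p * (A.map (algebraMap V K)).eval x := by
    intro x
    have := congrArg (eval x) hPA
    simpa using this
  have hQe : ∀ x : K, Q.eval (algebraMap V K t * x) = q * (B.map (algebraMap V K)).eval x := by
    intro x
    have := congrArg (eval x) hQB
    simpa using this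
  have hvp : valuation V K p ≠ 0 := (Valuation.ne_zero_iff _).2 hp
  have hvq : valuation V K q ≠ 0 := (Valuation.ne_zero_iff _).2 hq
  -- At `t * u` with `u` in `V` the maximum is the constant `v(t)`.
  have hAB : ∀ u : V, valuation V K (algebraMap V K (A.eval u)) =
      (valuation V K q * valuation V K (algebraMap V K t) / valuation V K p) *
        valuation V K (algebraMap V K (B.eval u)) := by
    intro u
    have := h (t * u)
    rw [map_mul, hPe, hQe, eval_map_algebraMap, eval_map_algebraMap, aeval_algebraMap_apply,
      aeval_algebraMap_apply, max_eq_right, map_mul, map_mul] at this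
    · simp only [coe_aeval_eq_eval] at this
      field_simp
      rw [mul_comm, this, mul_right_comm]
    · rw [map_mul]
      exact mul_le_of_le_one_right' ((mem_integer_iff V K _).2 ⟨u, rfl⟩)
  have hc := (eq_one_and_rootMultiplicity_eq hm hA hB hAB 0).1
  refine hasCoprimeDegreeRootless_of_rootMultiplicity_eq (f := A.map (residue V))
    (g := B.map (residue V)) (fun a => ?_) ?_
  · obtain ⟨α, rfl⟩ := residue_surjective a
    exact (eq_one_and_rootMultiplicity_eq hm hA hB hAB α).2
  obtain ⟨S, m, hS, hSA⟩ := valuation_eval_inv (K := K) A hA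
  obtain ⟨T, n, hT, hTB⟩ := valuation_eval_inv (K := K) B hB
  -- Including `t` makes `w = t / z` lie in `V`. There the maximum is `v(w) = v(t) / v(z)`, and the
  -- extra factor `1 / v(z)` yields the degree gap of one.
  obtain ⟨z, hz, hz0, hzd⟩ := exists_pow_dvd_finset_of_not_isPrincipal hm (m + n + 1)
    (insert t (S ∪ T)) (by
      intro s hs
      rcases Finset.mem_insert.1 hs with rfl | hs
      · exact ht
      · exact (Finset.mem_union.1 hs).elim (hS s) (hT s))
  have h1 := hSA z hz hz0 fun s hs => (pow_dvd_pow z (by omega)).trans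
    (hzd s (Finset.mem_insert_of_mem (Finset.mem_union_left _ hs)))
  have h2 := hTB z hz hz0 fun s hs => (pow_dvd_pow z (by omega)).trans
    (hzd s (Finset.mem_insert_of_mem (Finset.mem_union_right _ hs)))
  obtain ⟨w, rfl⟩ : z ∣ t := (dvd_pow_self z (by omega)).trans (hzd t (Finset.mem_insert_self _ _))
  have hz' : algebraMap V K z ≠ 0 := by simpa using hz0
  have hv : valuation V K (algebraMap V K z) ≠ 0 := (Valuation.ne_zero_iff _).2 hz'
  have hv1 := valuation_algebraMap_lt_one (K := K) hz
  have hw : algebraMap V K w = algebraMap V K (z * w) * (algebraMap V K z)⁻¹ := by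
    rw [map_mul]; field_simp
  have h3 := h w
  rw [max_eq_left (by rw [map_mul, map_mul]; exact mul_le_of_le_one_left' hv1.le), hw, hPe, hQe,
    map_mul, map_mul, map_mul (valuation V K) (algebraMap V K (z * w)), map_inv₀] at h3
  set γ := valuation V K (algebraMap V K z)
  set a := valuation V K ((A.map (algebraMap V K)).eval (algebraMap V K z)⁻¹)
  set b := valuation V K ((B.map (algebraMap V K)).eval (algebraMap V K z)⁻¹)
  set τ := valuation V K (algebraMap V K (z * w))
  have hpq : valuation V K q * τ = valuation V K p := by
    rwa [div_eq_one_iff_eq hvp] at hc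
  have h4 : a * γ = b := by
    rw [← hpq] at h3
    have h5 : valuation V K q * τ * (a * γ) = valuation V K q * τ * b := by
      rw [← mul_assoc, h3]; field_simp
    exact mul_left_cancel₀ (mul_ne_zero hvq hvt) h5
  have h6 : γ ^ ((B.map (residue V)).natDegree + 1) = γ ^ (A.map (residue V)).natDegree := by
    calc γ ^ ((B.map (residue V)).natDegree + 1)
        = (a * γ ^ (A.map (residue V)).natDegree) * γ ^ ((B.map (residue V)).natDegree + 1) := by
          rw [h1, one_mul]
      _ = (a * γ * γ ^ (B.map (residue V)).natDegree) * γ ^ (A.map (residue V)).natDegree := by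
          rw [pow_succ]; ac_rfl
      _ = _ := by rw [h4, h2, one_mul]
  exact (pow_right_injective₀ (zero_lt_iff.2 hv) hv1.ne h6).symm

end Valuation

/-! ### The ideal `(x, t)` and the main theorem. -/

section Main

open IsLocalRing ValuationRing

/-- Evaluation of integer-valued rational functions at an element of the base ring. -/
noncomputable def IntR.evalHom (D : Type*) (K : Type*) [CommRing D] [IsDomain D] [Field K] [Algebra D K]
    [IsFractionRing D K] (a : D) : IntR D K →+* K where
  toFun φ := φ.1.eval (RingHom.id K) (algebraMap D K a)
  map_one' := RatFunc.eval_one _ _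
  map_zero' := RatFunc.eval_zero _ _
  map_mul' φ ψ := RatFunc.eval_mul _ _ (by simpa [eval₂_id] using (φ.2 a).1)
    (by simpa [eval₂_id] using (ψ.2 a).1)
  map_add' φ ψ := RatFunc.eval_add _ _ (by simpa [eval₂_id] using (φ.2 a).1)
    (by simpa [eval₂_id] using (ψ.2 a).1)

variable {V K : Type*} [CommRing V] [IsDomain V] [ValuationRing V] [Field K] [Algebra V K]
  [IsFractionRing V K]

theorem IntR.not_isPrincipal_span_x_algebraMap (hm : ¬ (maximalIdeal V).IsPrincipal)
    (hk : ¬ HasCoprimeDegreeRootless (ResidueField V)) {t : V} (ht : t ∈ maximalIdeal V)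
    (ht0 : t ≠ 0) :
    ¬ (Ideal.span {IntR.x V K, algebraMap V (IntR V K) t}).IsPrincipal := by
  rintro ⟨d, hd⟩
  rw [← Ideal.span] at hd
  have hx : d ∣ IntR.x V K := Ideal.mem_span_singleton.1 (hd ▸ Ideal.subset_span (by simp))
  have hdt : d ∣ algebraMap V (IntR V K) t :=
    Ideal.mem_span_singleton.1 (hd ▸ Ideal.subset_span (by simp))
  obtain ⟨y, hy⟩ := hx
  obtain ⟨z, hz⟩ := hdt
  obtain ⟨u, w, huw⟩ := Ideal.mem_span_pair.1
    (hd.symm ▸ Ideal.mem_span_singleton_self d : d ∈ Ideal.span {_, _})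
  have hint : ∀ (φ : IntR V K) (a : V), valuation V K (IntR.evalHom V K a φ) ≤ 1 := fun φ a =>
    (mem_integer_iff V K _).2 (φ.2 a).2
  have hex : ∀ a, IntR.evalHom V K a (IntR.x V K) = algebraMap V K a := fun a =>
    RatFunc.eval_X _ _
  have het : ∀ a, IntR.evalHom V K a (algebraMap V (IntR V K) t) = algebraMap V K t := fun a => by
    change RatFunc.eval _ _ (algebraMap V (RatFunc K) t) = _
    rw [IsScalarTower.algebraMap_apply V K (RatFunc K), RatFunc.algebraMap_eq_C, RatFunc.eval_C]
    rfl
  refine hk (hasCoprimeDegreeRootless_of_valuation_eval hm ht ht0 d.1.num d.1.denom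
    (fun a => (d.2 a).1) fun a => ?_)
  have hval : IntR.evalHom V K a d =
      d.1.num.eval (algebraMap V K a) / d.1.denom.eval (algebraMap V K a) := by
    change RatFunc.eval _ _ _ = _
    rw [RatFunc.eval, eval₂_id, eval₂_id]
  have hv : valuation V K (IntR.evalHom V K a d) =
      max (valuation V K (algebraMap V K a)) (valuation V K (algebraMap V K t)) := by
    -- The upper bound holds since `d` is a combination of `x` and `t`, the lower ones since `d`
    -- divides both.
    refine le_antisymm ?_ (max_le ?_ ?_)
    · rw [← huw, map_add, map_mul, map_mul, hex, het]
      refine (Valuation.map_add _ _ _).trans (max_le_max ?_ ?_) <;> rw [map_mul] <;>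
        exact mul_le_of_le_one_left' (hint _ _)
    · rw [← hex, hy, map_mul, map_mul]
      exact mul_le_of_le_one_right' (hint _ _)
    · rw [← het a, hz, map_mul, map_mul]
      exact mul_le_of_le_one_right' (hint _ _)
  rw [← hv, hval, ← map_mul, mul_div_cancel₀ _ (d.2 a).1]

end Main

theorem mainTheorem3 {V : Type*} [CommRing V] [IsDomain V] [ValuationRing V]
    {K : Type*} [Field K] [Algebra V K] [IsFractionRing V K] :
    ((IsDomain (IntR V K) ∧ IsBezout (IntR V K)) ↔
      ((IsLocalRing.maximalIdeal V).IsPrincipal ∨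
        HasCoprimeDegreeRootless (IsLocalRing.ResidueField V))) ∧
    (¬ (IsLocalRing.maximalIdeal V).IsPrincipal →
      ¬ HasCoprimeDegreeRootless (IsLocalRing.ResidueField V) →
      ∀ t ∈ IsLocalRing.maximalIdeal V, t ≠ 0 →
        ¬ (Ideal.span {IntR.x V K, algebraMap V (IntR V K) t}).IsPrincipal) := by
  refine ⟨⟨fun ⟨_, hB⟩ => ?_, fun h => ⟨inferInstance, ?_⟩⟩, fun hm hk t ht ht0 =>
    IntR.not_isPrincipal_span_x_algebraMap hm hk ht ht0⟩
  · by_contra! h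
    obtain ⟨t, ht, ht0⟩ := Submodule.exists_mem_ne_zero_of_ne_bot
      (fun h0 : IsLocalRing.maximalIdeal V = ⊥ => h.1 (h0 ▸ inferInstance))
    exact IntR.not_isPrincipal_span_x_algebraMap (K := K) h.1 h.2 ht ht0
      (IsBezout.iff_span_pair_isPrincipal.1 hB _ _)
  · rcases h with ⟨t, ht⟩ | h
    · by_cases ht0 : t = 0
      · refine IntR.isBezout_of_isField (IsLocalRing.isField_iff_maximalIdeal_eq.2 ?_)
        rw [ht, ht0]; simp
      · exact (hasUnimodularForms_of_maximalIdeal_eq_span ht0 ht).isBezout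
    · exact (hasUnimodularForms_of_hasCoprimeDegreeRootless h).isBezout
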